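/- Let $G$ be a finite group. A semi-Mackey functor is a pair $M=(M^*,M_*)$ of a contravariant and a covariant functor from finite $G$-sets to commutative monoids which agree on objects, such that $M^*$ sends finite coproducts to products and the Mackey (base change) condition holds for pull-back squares; it is a Mackey functor if every $M(X)$ is an abelian group. A Tambara functor $T=(T^*,T_+,T_\bullet)$ takes values in commutative rings; its additive part $(T^*,T_+)$ and its multiplicative part $T^\mu=(T^*,T_\bullet)$ are semi-Mackey functors, and the distributive law for exponential diagrams holds. Fix a Tambara functor $T$. A $T$-Tambara functor is a Tambara functor $S$ with a morphism $\iota_T\colon T\to S$, and morphisms of $T$-Tambara functors are morphisms of Tambara functors under $T$. Write $\otimes_T$ for the coproduct of $T$-Tambara functors. For a semi-Mackey functor $M$ let $\Omega[M]$ be its Tambarization, i.e. the value at $M$ of the left adjoint of $S\mapsto S^\mu$, and let $T[M]=T\otimes_\Omega\Omega[M]$ be the coproduct of $T$ and $\Omega[M]$ as Tambara functors, regarded as a $T$-Tambara functor through the coprojection $T\to T[M]$. Let $M$ be a Mackey functor on $G$. The two inclusions $M\to M\oplus M$ induce an isomorphism $c\colon T[M]\otimes_T T[M]\to T[M\oplus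 M]$ of $T$-Tambara functors, the structure morphism $T\to T[0]$ is an isomorphism, and the morphisms of $T$-Tambara functors $$\Delta_M\colon T[M]\to T[M]\otimes_T T[M],\qquad \varepsilon_M\colon T[M]\to T,\qquad \eta_M\colon T[M]\to T[M]$$ that correspond, under $c$ and $T\cong T[0]$, to $T[\mathrm{diag}\colon M\to M\oplus M]$, $T[M\to 0]$ and $T[(-)^{-1}\colon M\to M]$ satisfy, up to the canonical associativity and unit isomorphisms of $\otimes_T$, $$(\Delta_M\otimes_T\mathrm{id})\circ\Delta_M=(\mathrm{id}\otimes_T\Delta_M)\circ\Delta_M,$$ $$(\varepsilon_M\otimes_T\mathrm{id})\circ\Delta_M=\mathrm{id}=(\mathrm{id}\otimes_T\varepsilon_M)\circ\Delta_M,$$ $$\nabla\circ(\eta_M\otimes_T\mathrm{id})\circ\Delta_M=\iota_T\circ\varepsilon_M=\nabla\circ(\mathrm{id}\otimes_T\eta_M)\circ\Delta_M,$$ where $\nabla\colon T[M]\otimes_T T[M]\to T[M]$ is the morphism that is the identity on each component. Thus $T[M]$ is a Hopf object among $T$-Tambara functors. -/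

import Mathlib

open CategoryTheory CategoryTheory.Limits

universe u w

/-! # Finite `G`-sets -/

/-- A finite `G`-set. -/
structure FinGSet (G : Type u) [Group G] where
  carrier : Type u
  [action : MulAction G carrier]
  [finite : Finite carrier]

namespace FinGSet

variable {G : Type u} [Group G]

instance : CoeSort (FinGSet G) (Type u) := ⟨FinGSet.carrier⟩

attribute [instance] FinGSet.action FinGSet.finite

/-- Morphisms of finite `G`-sets are the `G`-equivariant maps. -/
instance : Category (FinGSet G) where
  Hom X Y := X →[G] Y
  id X := MulActionHom.id G
  comp f g := MulActionHom.comp g f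

instance (X Y : FinGSet G) : FunLike (X ⟶ Y) X Y :=
  inferInstanceAs (FunLike (X →[G] Y) X Y)

/-- An equivariant map as a morphism of finite `G`-sets. -/
def ofHom {X Y : FinGSet G} (f : X → Y) (hf : ∀ (g : G) (x : X), f (g • x) = g • f x) : X ⟶ Y :=
  (⟨f, hf⟩ : X →[G] Y)

theorem map_smul {X Y : FinGSet G} (f : X ⟶ Y) (g : G) (x : X) : f (g • x) = g • f x :=
  MulActionHom.map_smul' f g x

theorem hom_ext {X Y : FinGSet G} {f g : X ⟶ Y} (h : ∀ x, f x = g x) : f = g :=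
  DFunLike.ext f g h

/-! ## Exponential diagrams -/

/-- The set `Π_f(A)` of pairs `(y, σ)`, where `y ∈ Y` and `σ : f⁻¹(y) → A` is a map of sets such
that `p ∘ σ` is the identity on `f⁻¹(y)`. -/
structure PiSet {X Y A : FinGSet G} (f : X ⟶ Y) (p : A ⟶ X) where
  pt : Y
  sec : {x : X // f x = pt} → A
  is_sec : ∀ x, p (sec x) = x.1

section Pi

variable {X Y A : FinGSet G} (f : X ⟶ Y) (p : A ⟶ X)

variable {f p} in
theorem PiSet.ext' {s t : PiSet f p} (h : s.pt = t.pt)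
    (h' : ∀ x (hs : f x = s.pt) (ht : f x = t.pt), s.sec ⟨x, hs⟩ = t.sec ⟨x, ht⟩) : s = t := by
  obtain ⟨y, σ, hσ⟩ := s
  obtain ⟨z, τ, hτ⟩ := t
  obtain rfl : y = z := h
  obtain rfl : σ = τ := funext fun x => h' x.1 x.2 x.2
  rfl

theorem inv_smul_mem_fiber {g : G} {y : Y} {x : X} (hx : f x = g • y) : f (g⁻¹ • x) = y := by
  rw [map_smul, hx, inv_smul_smul]

variable {f p} in
theorem PiSet.sec_congr (s : PiSet f p) {x x' : X} (h : x = x') (hx : f x = s.pt)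
    (hx' : f x' = s.pt) : s.sec ⟨x, hx⟩ = s.sec ⟨x', hx'⟩ := by
  subst h; rfl

/-- `G` acts on `Π_f(A)` by `g • (y, σ) = (g • y, x ↦ g • σ (g⁻¹ • x))`. -/
instance : MulAction G (PiSet f p) where
  smul g s :=
    { pt := g • s.pt
      sec := fun x => g • s.sec ⟨g⁻¹ • x.1, inv_smul_mem_fiber f x.2⟩
      is_sec := fun x => by rw [map_smul, s.is_sec, smul_inv_smul] }
  one_smul s := by
    refine PiSet.ext' (one_smul G s.pt) fun x h h' => ?_
    refine (one_smul G _).trans (s.sec_congr ?_ _ _)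
    rw [inv_one, one_smul]
  mul_smul g h s := by
    refine PiSet.ext' (mul_smul g h s.pt) fun x _ _ => ?_
    refine (mul_smul g h _).trans (congrArg (g • h • ·) (s.sec_congr ?_ _ _))
    rw [mul_inv_rev, mul_smul]

instance : Finite (PiSet f p) :=
  Finite.of_injective (β := Σ y : Y, {x : X // f x = y} → A) (fun s => ⟨s.pt, s.sec⟩) (by
    rintro ⟨y, σ, hσ⟩ ⟨z, τ, hτ⟩ h
    simp only [Sigma.mk.injEq] at h
    obtain ⟨rfl, h⟩ := h
    obtain rfl := eq_of_heq h
    rfl)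

/-- The finite `G`-set `Π_f(A)`. -/
def piObj : FinGSet G := ⟨PiSet f p⟩

/-- The projection `π : Π_f(A) → Y`, `(y, σ) ↦ y`. -/
def piProj : piObj f p ⟶ Y := ofHom (fun s : PiSet f p => s.pt) fun _ _ => rfl

/-- The underlying set of the fibre product `X ×_Y Π_f(A)`. -/
abbrev PiPullback := {z : X × PiSet f p // f z.1 = z.2.pt}

instance : MulAction G (PiPullback f p) where
  smul g z := ⟨(g • z.1.1, g • z.1.2), by
    have h := congrArg (g • ·) z.2
    exact (map_smul f g z.1.1).trans h⟩
  one_smul z := Subtype.ext (one_smul G z.1)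
  mul_smul g h z := Subtype.ext (mul_smul g h z.1)

/-- The finite `G`-set `X ×_Y Π_f(A)`. -/
def piPullback : FinGSet G := ⟨PiPullback f p⟩

/-- The evaluation `e : X ×_Y Π_f(A) → A`, `(x, (y, σ)) ↦ σ x`. -/
def piEval : piPullback f p ⟶ A :=
  ofHom (fun z : PiPullback f p => z.1.2.sec ⟨z.1.1, z.2⟩) fun g z => by
    refine congrArg (g • ·) (z.1.2.sec_congr ?_ _ _)
    exact inv_smul_smul g z.1.1

/-- The projection `f' : X ×_Y Π_f(A) → Π_f(A)`, that is, the pull-back of `f` along `π`. -/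
def piSnd : piPullback f p ⟶ piObj f p :=
  ofHom (fun z : PiPullback f p => z.1.2) fun _ _ => rfl

/-- The diagram `Y ←f- X ←p- A ←l- Z -r→ B -q→ Y` is an exponential diagram: it is isomorphic to
the canonical exponential diagram `Y ←f- X ←p- A ←e- X ×_Y Π_f(A) -f'→ Π_f(A) -π→ Y`. -/
def IsExponential {Z B : FinGSet G} (l : Z ⟶ A) (r : Z ⟶ B) (q : B ⟶ Y) : Prop :=
  ∃ (z : Z ≅ piPullback f p) (b : B ≅ piObj f p),
    l = z.hom ≫ piEval f p ∧ r ≫ b.hom = z.hom ≫ piSnd f p ∧ q = b.hom ≫ piProj f p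

end Pi

/-! ## Finite `G`-sets form an essentially small category -/

instance (X Y : FinGSet G) : Finite (X ⟶ Y) :=
  Finite.of_injective (β := X → Y) (fun f => (f : X → Y)) DFunLike.coe_injective

variable [Finite G]

instance (n : ℕ) : Finite (MulAction G (Fin n)) :=
  Finite.of_injective (β := G → Fin n → Fin n) (fun a => a.smul) (by
    intro a b h
    exact MulAction.ext (funext fun g => funext fun x => congrFun (congrFun h g) x))

/-- A `G`-action on `Fin n`, as a finite `G`-set. -/
def ofFin (s : Σ n : ℕ, MulAction G (Fin n)) : FinGSet G :=
  letI := s.2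
  ⟨ULift.{u} (Fin s.1)⟩

instance : Small.{w} (Skeleton (FinGSet G)) := by
  have : Function.Surjective
      (fun s : Σ n : ℕ, MulAction G (Fin n) => toSkeleton (ofFin s)) := by
    intro X
    obtain ⟨X, rfl⟩ : ∃ Y, toSkeleton Y = X := Quotient.exists_rep X
    obtain ⟨n, ⟨e⟩⟩ := Finite.exists_equiv_fin X
    let a : MulAction G (Fin n) := e.symm.mulAction G
    have he : ∀ (g : G) (i : Fin n), g • i = e (g • e.symm i) := fun g i => rfl
    refine ⟨⟨n, a⟩, ?_⟩
    refine Quotient.sound ⟨⟨ofHom (fun i : ULift (Fin n) => e.symm i.down) ?_,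
      ofHom (fun x => (ULift.up (e x) : ULift (Fin n))) ?_, ?_, ?_⟩⟩
    · intro g i
      change e.symm (g • i.down) = _
      rw [he, Equiv.symm_apply_apply]
    · intro g x
      refine congrArg ULift.up ?_
      change _ = g • e x
      rw [he, Equiv.symm_apply_apply]
    · exact hom_ext fun i => congrArg ULift.up (e.apply_symm_apply i.down)
    · exact hom_ext fun x => e.symm_apply_apply x
  exact small_of_surjective this

instance : EssentiallySmall.{w} (FinGSet G) :=
  (essentiallySmall_iff _).2 ⟨inferInstance, ⟨fun _ _ => inferInstance⟩⟩

end FinGSet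

/-! # Semi-Mackey functors and Mackey functors -/

/-- A semi-Mackey functor on `G`. The commutative monoid structures, written multiplicatively, for
which restrictions and transfers are homomorphisms are bundled; by additivity they are determined by
the underlying set-valued functors, the product of `a` and `b` in `M(X)` being the transfer along
`X ⨿ X → X` of the element of `M(X ⨿ X) ≅ M(X) × M(X)` given by `(a, b)`. -/
structure SemiMackeyFunctor (G : Type u) [Group G] where
  obj : FinGSet G → Type w
  [commMonoid : ∀ X, CommMonoid (obj X)]
  /-- The restriction along `f`. -/
  res {X Y : FinGSet G} (f : X ⟶ Y) : obj Y →* obj X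
  /-- The transfer along `f`. -/
  tr {X Y : FinGSet G} (f : X ⟶ Y) : obj X →* obj Y
  res_id (X : FinGSet G) (a : obj X) : res (𝟙 X) a = a
  res_comp {X Y Z : FinGSet G} (f : X ⟶ Y) (g : Y ⟶ Z) (a : obj Z) :
    res (f ≫ g) a = res f (res g a)
  tr_id (X : FinGSet G) (a : obj X) : tr (𝟙 X) a = a
  tr_comp {X Y Z : FinGSet G} (f : X ⟶ Y) (g : Y ⟶ Z) (a : obj X) :
    tr (f ≫ g) a = tr g (tr f a)
  /-- Additivity: the initial object is sent to a one-point set. -/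
  subsingleton_initial (X : FinGSet G) (h : IsInitial X) : Subsingleton (obj X)
  /-- Additivity: binary coproducts are sent to products. -/
  bijective_coprod {X Y Z : FinGSet G} (i : X ⟶ Z) (j : Y ⟶ Z)
    (h : IsColimit (BinaryCofan.mk i j)) :
    Function.Bijective fun a : obj Z => (res i a, res j a)
  /-- The Mackey condition. -/
  mackey {X' Y' X Y : FinGSet G} {f' : X' ⟶ Y'} {x : X' ⟶ X} {y : Y' ⟶ Y} {f : X ⟶ Y}
    (h : IsPullback f' x y f) (a : obj Y') : tr x (res f' a) = res f (tr y a)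

namespace SemiMackeyFunctor

variable {G : Type u} [Group G]

attribute [instance] SemiMackeyFunctor.commMonoid

/-- A morphism of semi-Mackey functors: a family of monoid homomorphisms, natural with respect to
restrictions and transfers. -/
@[ext]
structure Hom (M N : SemiMackeyFunctor.{u, w} G) where
  app (X : FinGSet G) : M.obj X →* N.obj X
  app_res {X Y : FinGSet G} (f : X ⟶ Y) (a : M.obj Y) : app X (M.res f a) = N.res f (app Y a)
  app_tr {X Y : FinGSet G} (f : X ⟶ Y) (a : M.obj X) : app Y (M.tr f a) = N.tr f (app X a)

instance : Category (SemiMackeyFunctor.{u, w} G) where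
  Hom := Hom
  id M :=
    { app := fun X => MonoidHom.id _
      app_res := fun _ _ => rfl
      app_tr := fun _ _ => rfl }
  comp φ ψ :=
    { app := fun X => (ψ.app X).comp (φ.app X)
      app_res := fun f a => by simp [φ.app_res, ψ.app_res]
      app_tr := fun f a => by simp [φ.app_tr, ψ.app_tr] }

/-- A semi-Mackey functor is a Mackey functor if each `M(X)` is an abelian group. -/
def IsMackey : ObjectProperty (SemiMackeyFunctor.{u, w} G) :=
  fun M => ∀ (X : FinGSet G) (a : M.obj X), IsUnit a

/-- The semi-Mackey functor `0`. -/
def zero : SemiMackeyFunctor.{u, w} G where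
  obj _ := PUnit
  res _ := 1
  tr _ := 1
  res_id _ _ := rfl
  res_comp _ _ _ := rfl
  tr_id _ _ := rfl
  tr_comp _ _ _ := rfl
  subsingleton_initial _ _ := inferInstance
  bijective_coprod _ _ _ := ⟨fun _ _ _ => rfl, fun _ => ⟨PUnit.unit, rfl⟩⟩
  mackey _ _ := rfl

/-- The direct sum `M ⊕ N`, given by `(M ⊕ N)(X) = M(X) × N(X)`. -/
def directSum (M N : SemiMackeyFunctor.{u, w} G) : SemiMackeyFunctor.{u, w} G where
  obj X := M.obj X × N.obj X
  res f := (M.res f).prodMap (N.res f)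
  tr f := (M.tr f).prodMap (N.tr f)
  res_id X a := Prod.ext (M.res_id X a.1) (N.res_id X a.2)
  res_comp f g a := Prod.ext (M.res_comp f g a.1) (N.res_comp f g a.2)
  tr_id X a := Prod.ext (M.tr_id X a.1) (N.tr_id X a.2)
  tr_comp f g a := Prod.ext (M.tr_comp f g a.1) (N.tr_comp f g a.2)
  subsingleton_initial X h :=
    have := M.subsingleton_initial X h
    have := N.subsingleton_initial X h
    inferInstance
  bijective_coprod i j h := by
    constructor
    · intro a b hab
      simp only [MonoidHom.prodMap, MonoidHom.prod_apply, MonoidHom.comp_apply,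
        MonoidHom.coe_fst, MonoidHom.coe_snd, Prod.mk.injEq] at hab
      exact Prod.ext
        ((M.bijective_coprod i j h).1 (Prod.ext hab.1.1 hab.2.1))
        ((N.bijective_coprod i j h).1 (Prod.ext hab.1.2 hab.2.2))
    · rintro ⟨⟨a, a'⟩, b, b'⟩
      obtain ⟨c, hc⟩ := (M.bijective_coprod i j h).2 (a, b)
      obtain ⟨d, hd⟩ := (N.bijective_coprod i j h).2 (a', b')
      rw [Prod.mk.injEq] at hc hd
      exact ⟨(c, d), Prod.ext (Prod.ext hc.1 hd.1) (Prod.ext hc.2 hd.2)⟩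
  mackey h a := Prod.ext (M.mackey h a.1) (N.mackey h a.2)

/-- The inclusion `M → M ⊕ N`. -/
def inl (M N : SemiMackeyFunctor.{u, w} G) : M ⟶ M.directSum N where
  app _ := MonoidHom.inl _ _
  app_res f _ := Prod.ext rfl (map_one (N.res f)).symm
  app_tr f _ := Prod.ext rfl (map_one (N.tr f)).symm

/-- The inclusion `N → M ⊕ N`. -/
def inr (M N : SemiMackeyFunctor.{u, w} G) : N ⟶ M.directSum N where
  app _ := MonoidHom.inr _ _
  app_res f _ := Prod.ext (map_one (M.res f)).symm rfl
  app_tr f _ := Prod.ext (map_one (M.tr f)).symm rfl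

/-- The diagonal morphism `M → M ⊕ M`. -/
def diag (M : SemiMackeyFunctor.{u, w} G) : M ⟶ M.directSum M where
  app _ := (MonoidHom.id _).prod (MonoidHom.id _)
  app_res _ _ := rfl
  app_tr _ _ := rfl

/-- The zero morphism `M → 0`. -/
def toZero (M : SemiMackeyFunctor.{u, w} G) : M ⟶ zero where
  app _ := 1
  app_res _ _ := rfl
  app_tr _ _ := rfl

end SemiMackeyFunctor

/-- The category of Mackey functors, a full subcategory of the category of semi-Mackey functors. -/
abbrev MackeyFunctor (G : Type u) [Group G] :=
  (SemiMackeyFunctor.IsMackey.{u, w} (G := G)).FullSubcategory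

namespace MackeyFunctor

variable {G : Type u} [Group G]

/-- The inverse of an element of `M(X)`. -/
noncomputable def inv (M : MackeyFunctor.{u, w} G) {X : FinGSet G} (a : M.obj.obj X) :
    M.obj.obj X :=
  ((M.property X a).unit⁻¹ : (M.obj.obj X)ˣ)

theorem mul_inv_self (M : MackeyFunctor.{u, w} G) {X : FinGSet G} (a : M.obj.obj X) :
    a * M.inv a = 1 :=
  (M.property X a).mul_val_inv

theorem inv_eq (M : MackeyFunctor.{u, w} G) {X : FinGSet G} {a b : M.obj.obj X} (h : a * b = 1) :
    M.inv a = b :=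
  left_inv_eq_right_inv ((mul_comm _ _).trans (M.mul_inv_self a)) h

/-- The inversion `M → M`, `a ↦ a⁻¹`, of a Mackey functor (its group law is written
multiplicatively). -/
noncomputable def inversion (M : MackeyFunctor.{u, w} G) : M.obj ⟶ M.obj where
  app X :=
    { toFun := fun a => M.inv a
      map_one' := M.inv_eq (one_mul 1)
      map_mul' := fun a b => M.inv_eq (by
        rw [mul_mul_mul_comm, mul_inv_self, mul_inv_self, one_mul]) }
  app_res f a := M.inv_eq (by
    change _ * M.obj.res f (M.inv a) = 1
    rw [← map_mul, mul_inv_self, map_one])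
  app_tr f a := M.inv_eq (by
    change _ * M.obj.tr f (M.inv a) = 1
    rw [← map_mul, mul_inv_self, map_one])

end MackeyFunctor

/-! # Tambara functors -/

/-- A Tambara functor on `G`. The commutative ring structures, for which restrictions are ring
homomorphisms, additive transfers are additive and multiplicative transfers are multiplicative, are
bundled; by additivity they are determined by the underlying set-valued functors. -/
structure TambaraFunctor (G : Type u) [Group G] where
  obj : FinGSet G → Type w
  [commRing : ∀ X, CommRing (obj X)]
  /-- The restriction along `f`. -/
  res {X Y : FinGSet G} (f : X ⟶ Y) : obj Y →+* obj X
  /-- The additive transfer along `f`. -/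
  tr {X Y : FinGSet G} (f : X ⟶ Y) : obj X →+ obj Y
  /-- The multiplicative transfer along `f`. -/
  nm {X Y : FinGSet G} (f : X ⟶ Y) : obj X →* obj Y
  res_id (X : FinGSet G) (a : obj X) : res (𝟙 X) a = a
  res_comp {X Y Z : FinGSet G} (f : X ⟶ Y) (g : Y ⟶ Z) (a : obj Z) :
    res (f ≫ g) a = res f (res g a)
  tr_id (X : FinGSet G) (a : obj X) : tr (𝟙 X) a = a
  tr_comp {X Y Z : FinGSet G} (f : X ⟶ Y) (g : Y ⟶ Z) (a : obj X) :
    tr (f ≫ g) a = tr g (tr f a)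
  nm_id (X : FinGSet G) (a : obj X) : nm (𝟙 X) a = a
  nm_comp {X Y Z : FinGSet G} (f : X ⟶ Y) (g : Y ⟶ Z) (a : obj X) :
    nm (f ≫ g) a = nm g (nm f a)
  /-- Additivity: the initial object is sent to a one-point set. -/
  subsingleton_initial (X : FinGSet G) (h : IsInitial X) : Subsingleton (obj X)
  /-- Additivity: binary coproducts are sent to products. -/
  bijective_coprod {X Y Z : FinGSet G} (i : X ⟶ Z) (j : Y ⟶ Z)
    (h : IsColimit (BinaryCofan.mk i j)) :
    Function.Bijective fun a : obj Z => (res i a, res j a)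
  /-- The Mackey condition for the additive transfers. -/
  mackey_tr {X' Y' X Y : FinGSet G} {f' : X' ⟶ Y'} {x : X' ⟶ X} {y : Y' ⟶ Y} {f : X ⟶ Y}
    (h : IsPullback f' x y f) (a : obj Y') : tr x (res f' a) = res f (tr y a)
  /-- The Mackey condition for the multiplicative transfers. -/
  mackey_nm {X' Y' X Y : FinGSet G} {f' : X' ⟶ Y'} {x : X' ⟶ X} {y : Y' ⟶ Y} {f : X ⟶ Y}
    (h : IsPullback f' x y f) (a : obj Y') : nm x (res f' a) = res f (nm y a)
  /-- The distributive law. -/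
  distrib {X Y A Z B : FinGSet G} {f : X ⟶ Y} {p : A ⟶ X} {l : Z ⟶ A} {r : Z ⟶ B} {q : B ⟶ Y}
    (h : FinGSet.IsExponential f p l r q) (a : obj A) :
    nm f (tr p a) = tr q (nm r (res l a))

namespace TambaraFunctor

variable {G : Type u} [Group G]

attribute [instance] TambaraFunctor.commRing

/-- A morphism of Tambara functors: a family of ring homomorphisms, natural with respect to
restrictions, additive transfers and multiplicative transfers. -/
@[ext]
structure Hom (T S : TambaraFunctor.{u, w} G) where
  app (X : FinGSet G) : T.obj X →+* S.obj X
  app_res {X Y : FinGSet G} (f : X ⟶ Y) (a : T.obj Y) : app X (T.res f a) = S.res f (app Y a)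
  app_tr {X Y : FinGSet G} (f : X ⟶ Y) (a : T.obj X) : app Y (T.tr f a) = S.tr f (app X a)
  app_nm {X Y : FinGSet G} (f : X ⟶ Y) (a : T.obj X) : app Y (T.nm f a) = S.nm f (app X a)

instance : Category (TambaraFunctor.{u, w} G) where
  Hom := Hom
  id T :=
    { app := fun X => RingHom.id _
      app_res := fun _ _ => rfl
      app_tr := fun _ _ => rfl
      app_nm := fun _ _ => rfl }
  comp φ ψ :=
    { app := fun X => (ψ.app X).comp (φ.app X)
      app_res := fun f a => by simp [φ.app_res, ψ.app_res]
      app_tr := fun f a => by simp [φ.app_tr, ψ.app_tr]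
      app_nm := fun f a => by simp [φ.app_nm, ψ.app_nm] }

theorem hom_ext {T S : TambaraFunctor.{u, w} G} {φ ψ : T ⟶ S}
    (h : ∀ X (a : T.obj X), φ.app X a = ψ.app X a) : φ = ψ :=
  Hom.ext (funext fun X => RingHom.ext (h X))

/-- The functor `T ↦ T^μ` sending a Tambara functor to its multiplicative part. -/
def mulPart (G : Type u) [Group G] : TambaraFunctor.{u, w} G ⥤ SemiMackeyFunctor.{u, w} G where
  obj T :=
    { obj := T.obj
      res := fun f => (T.res f).toMonoidHom
      tr := T.nm
      res_id := T.res_id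
      res_comp := T.res_comp
      tr_id := T.nm_id
      tr_comp := T.nm_comp
      subsingleton_initial := T.subsingleton_initial
      bijective_coprod := T.bijective_coprod
      mackey := T.mackey_nm }
  map φ :=
    { app := fun X => (φ.app X).toMonoidHom
      app_res := φ.app_res
      app_tr := φ.app_nm }

/-! ## Tambara functors given by generators and relations -/

section Presentation

/-- The element of `T(X ⨿ Y)` with given restrictions to `X` and `Y`. -/
noncomputable def glue (T : TambaraFunctor.{u, w} G) {X Y Z : FinGSet G} {i : X ⟶ Z} {j : Y ⟶ Z}
    (h : Nonempty (IsColimit (BinaryCofan.mk i j))) (a : T.obj X) (b : T.obj Y) : T.obj Z :=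
  ((T.bijective_coprod i j h.some).2 (a, b)).choose

theorem res_glue (T : TambaraFunctor.{u, w} G) {X Y Z : FinGSet G} {i : X ⟶ Z} {j : Y ⟶ Z}
    (h : Nonempty (IsColimit (BinaryCofan.mk i j))) (a : T.obj X) (b : T.obj Y) :
    T.res i (T.glue h a b) = a ∧ T.res j (T.glue h a b) = b :=
  Prod.ext_iff.1 ((T.bijective_coprod i j h.some).2 (a, b)).choose_spec

theorem eq_glue (T : TambaraFunctor.{u, w} G) {X Y Z : FinGSet G} {i : X ⟶ Z} {j : Y ⟶ Z}
    (h : Nonempty (IsColimit (BinaryCofan.mk i j))) {a : T.obj X} {b : T.obj Y} {c : T.obj Z}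
    (ha : T.res i c = a) (hb : T.res j c = b) : c = T.glue h a b :=
  (T.bijective_coprod i j h.some).1
    (Prod.ext (ha.trans (T.res_glue h a b).1.symm) (hb.trans (T.res_glue h a b).2.symm))

theorem tr_res_iso (T : TambaraFunctor.{u, w} G) {X Y X' Y' : FinGSet G} (e : X ≅ X')
    (d : Y ≅ Y') {f : X ⟶ Y} {f' : X' ⟶ Y'} (h : e.hom ≫ f' = f ≫ d.hom) (a : T.obj X') :
    T.res d.hom (T.tr f' a) = T.tr f (T.res e.hom a) :=
  (T.mackey_tr (IsPullback.of_horiz_isIso ⟨h⟩) a).symm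

theorem nm_res_iso (T : TambaraFunctor.{u, w} G) {X Y X' Y' : FinGSet G} (e : X ≅ X')
    (d : Y ≅ Y') {f : X ⟶ Y} {f' : X' ⟶ Y'} (h : e.hom ≫ f' = f ≫ d.hom) (a : T.obj X') :
    T.res d.hom (T.nm f' a) = T.nm f (T.res e.hom a) :=
  (T.mackey_nm (IsPullback.of_horiz_isIso ⟨h⟩) a).symm

variable [Finite G]

/-- A small category of finite `G`-sets. -/
abbrev Sm (G : Type u) [Group G] [Finite G] : Type w := SmallModel.{w} (FinGSet G)

/-- The equivalence from the small model to finite `G`-sets. -/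
noncomputable abbrev smF (G : Type u) [Group G] [Finite G] : Sm.{u, w} G ⥤ FinGSet G :=
  (equivSmallModel.{w} (FinGSet G)).inverse

noncomputable def sm (X : FinGSet G) : Sm.{u, w} G := (smF.{u, w} G).objPreimage X

noncomputable def smIso (X : FinGSet G) : X ≅ (smF.{u, w} G).obj (sm X) :=
  ((smF.{u, w} G).objObjPreimageIso X).symm

noncomputable def smMap {X Y : FinGSet G} (f : X ⟶ Y) : sm.{u, w} X ⟶ sm Y :=
  (smF.{u, w} G).preimage ((smIso X).inv ≫ f ≫ (smIso Y).hom)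

theorem smMap_comm {X Y : FinGSet G} (f : X ⟶ Y) :
    (smIso.{u, w} X).hom ≫ (smF.{u, w} G).map (smMap f) = f ≫ (smIso Y).hom := by
  simp [smMap]

theorem smMap_coprod {X Y Z : FinGSet G} {i : X ⟶ Z} {j : Y ⟶ Z}
    (h : Nonempty (IsColimit (BinaryCofan.mk i j))) :
    Nonempty (IsColimit (BinaryCofan.mk ((smF.{u, w} G).map (smMap i))
      ((smF.{u, w} G).map (smMap j)))) := by
  have hi := smMap_comm.{u, w} i
  have hj := smMap_comm.{u, w} j
  rw [← Iso.eq_inv_comp] at hi hj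
  rw [hi, hj]
  obtain ⟨h⟩ := h
  have ex (W : FinGSet G) (a : (smF.{u, w} G).obj (sm X) ⟶ W)
      (b : (smF.{u, w} G).obj (sm Y) ⟶ W) : ∃ c : (smF.{u, w} G).obj (sm Z) ⟶ W,
      ((smIso X).inv ≫ i ≫ (smIso Z).hom) ≫ c = a ∧
      ((smIso Y).inv ≫ j ≫ (smIso Z).hom) ≫ c = b := by
    obtain ⟨c, hc, hc'⟩ : ∃ c : Z ⟶ W, i ≫ c = (smIso X).hom ≫ a ∧ j ≫ c = (smIso Y).hom ≫ b :=
      ⟨_, (BinaryCofan.IsColimit.desc' h ((smIso X).hom ≫ a) ((smIso Y).hom ≫ b)).2⟩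
    exact ⟨(smIso Z).inv ≫ c, by simp [hc], by simp [hc']⟩
  have un (W : FinGSet G) (c d : (smF.{u, w} G).obj (sm Z) ⟶ W)
      (hi : ((smIso X).inv ≫ i ≫ (smIso Z).hom) ≫ c = ((smIso X).inv ≫ i ≫ (smIso Z).hom) ≫ d)
      (hj : ((smIso Y).inv ≫ j ≫ (smIso Z).hom) ≫ c = ((smIso Y).inv ≫ j ≫ (smIso Z).hom) ≫ d) :
      c = d := by
    rw [← cancel_epi (smIso Z).hom]
    simp only [Category.assoc, cancel_epi] at hi hj
    exact BinaryCofan.IsColimit.hom_ext h hi hj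
  exact ⟨BinaryCofan.isColimitMk (fun s => (ex _ s.inl s.inr).choose)
    (fun s => (ex _ s.inl s.inr).choose_spec.1) (fun s => (ex _ s.inl s.inr).choose_spec.2)
    (fun s m h1 h2 => un _ _ _ (h1.trans (ex _ s.inl s.inr).choose_spec.1.symm)
      (h2.trans (ex _ s.inl s.inr).choose_spec.2.symm))⟩

/-- Terms in the operations of a Tambara functor, with generators in `gen`. -/
inductive Term (gen : FinGSet G → Type w) : Sm.{u, w} G → Type w
  | of {i : Sm.{u, w} G} (x : gen ((smF G).obj i)) : Term gen i
  | zero {i : Sm.{u, w} G} : Term gen i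
  | one {i : Sm.{u, w} G} : Term gen i
  | neg {i : Sm.{u, w} G} (s : Term gen i) : Term gen i
  | add {i : Sm.{u, w} G} (s t : Term gen i) : Term gen i
  | mul {i : Sm.{u, w} G} (s t : Term gen i) : Term gen i
  | res {i j : Sm.{u, w} G} (f : i ⟶ j) (s : Term gen j) : Term gen i
  | tr {i j : Sm.{u, w} G} (f : i ⟶ j) (s : Term gen i) : Term gen j
  | nm {i j : Sm.{u, w} G} (f : i ⟶ j) (s : Term gen i) : Term gen j
  | glue {i j k : Sm.{u, w} G} (f : i ⟶ k) (g : j ⟶ k)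
      (h : Nonempty (IsColimit (BinaryCofan.mk ((smF G).map f) ((smF G).map g))))
      (s : Term gen i) (t : Term gen j) : Term gen k

variable {gen : FinGSet G → Type w}

/-- The value of a term in a Tambara functor, given values of the generators. -/
noncomputable def Term.eval (S : TambaraFunctor.{u, w} G) (φ : ∀ X, gen X → S.obj X) :
    ∀ {i : Sm.{u, w} G}, Term gen i → S.obj ((smF G).obj i)
  | _, .of x => φ _ x
  | _, .zero => 0
  | _, .one => 1
  | _, .neg s => - s.eval S φ
  | _, .add s t => s.eval S φ + t.eval S φ
  | _, .mul s t => s.eval S φ * t.eval S φ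
  | _, .res f s => S.res ((smF G).map f) (s.eval S φ)
  | _, .tr f s => S.tr ((smF G).map f) (s.eval S φ)
  | _, .nm f s => S.nm ((smF G).map f) (s.eval S φ)
  | _, .glue _ _ h s t => S.glue h (s.eval S φ) (t.eval S φ)

theorem Term.eval_map {S S' : TambaraFunctor.{u, w} G} (ψ : S ⟶ S') (φ : ∀ X, gen X → S.obj X)
    {i : Sm.{u, w} G} (t : Term gen i) :
    t.eval S' (fun X x => ψ.app X (φ X x)) = ψ.app _ (t.eval S φ) := by
  induction t with
  | of x => rfl
  | zero => exact (map_zero _).symm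
  | one => exact (map_one _).symm
  | neg s hs => simp only [Term.eval, hs, map_neg]
  | add s t hs ht => simp only [Term.eval, hs, ht, map_add]
  | mul s t hs ht => simp only [Term.eval, hs, ht, map_mul]
  | res f s hs => simp only [Term.eval, hs, ψ.app_res]
  | tr f s hs => simp only [Term.eval, hs, ψ.app_tr]
  | nm f s hs => simp only [Term.eval, hs, ψ.app_nm]
  | glue f g h s t hs ht =>
    simp only [Term.eval, hs, ht]
    refine (S'.eq_glue h ?_ ?_).symm
    · rw [← ψ.app_res, (S.res_glue h _ _).1]
    · rw [← ψ.app_res, (S.res_glue h _ _).2]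

variable (gen) in
/-- A system of relations on the generators, given by the assignments that satisfy them. -/
abbrev Relations := ∀ S : TambaraFunctor.{u, w} G, (∀ X, gen X → S.obj X) → Prop

/-- The value in `S(X)` of a term over the small model of `X`. -/
noncomputable def Term.val (S : TambaraFunctor.{u, w} G) (φ : ∀ X, gen X → S.obj X)
    {X : FinGSet G} (t : Term gen (sm X)) : S.obj X :=
  S.res (smIso X).hom (t.eval S φ)

variable (R : Relations gen)

/-- Two terms are identified if they have the same value for every assignment that satisfies the
relations. -/
def termSetoid (X : FinGSet G) : Setoid (Term gen (sm X)) where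
  r s t := ∀ S φ, R S φ → s.val S φ = t.val S φ
  iseqv := ⟨fun _ _ _ _ => rfl, fun h S φ hφ => (h S φ hφ).symm,
    fun h h' S φ hφ => (h S φ hφ).trans (h' S φ hφ)⟩

def PresObj (X : FinGSet G) : Type w := Quotient (termSetoid R X)

namespace PresObj

variable {R} {X Y Z : FinGSet G}

noncomputable def val (S : TambaraFunctor.{u, w} G) (φ : ∀ X, gen X → S.obj X) (hφ : R S φ) :
    PresObj R X → S.obj X :=
  Quotient.lift (fun t => t.val S φ) fun _ _ h => h S φ hφ

theorem ext {a b : PresObj R X} (h : ∀ S φ hφ, a.val S φ hφ = b.val S φ hφ) : a = b := by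
  induction a using Quotient.inductionOn with | _ a
  induction b using Quotient.inductionOn with | _ b
  exact Quotient.sound h

/-- An operation on values that lifts to terms descends to the quotient. -/
theorem exists_unary (op : ∀ S : TambaraFunctor.{u, w} G, S.obj X → S.obj Y)
    (top : Term gen (sm X) → Term gen (sm Y))
    (h : ∀ S φ t, (top t).val S φ = op S (t.val S φ)) (a : PresObj R X) :
    ∃ b : PresObj R Y, ∀ S φ hφ, b.val S φ hφ = op S (a.val S φ hφ) := by
  induction a using Quotient.inductionOn with | _ a
  exact ⟨Quotient.mk _ (top a), fun S φ _ => h S φ a⟩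

theorem exists_binary (op : ∀ S : TambaraFunctor.{u, w} G, S.obj X → S.obj Y → S.obj Z)
    (top : Term gen (sm X) → Term gen (sm Y) → Term gen (sm Z))
    (h : ∀ S φ s t, (top s t).val S φ = op S (s.val S φ) (t.val S φ))
    (a : PresObj R X) (b : PresObj R Y) :
    ∃ c : PresObj R Z, ∀ S φ hφ, c.val S φ hφ = op S (a.val S φ hφ) (b.val S φ hφ) := by
  induction a using Quotient.inductionOn with | _ a
  induction b using Quotient.inductionOn with | _ b
  exact ⟨Quotient.mk _ (top a b), fun S φ _ => h S φ a b⟩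

theorem exists_zero : ∃ c : PresObj R X, ∀ S φ hφ, c.val S φ hφ = 0 :=
  ⟨Quotient.mk _ .zero, fun S _ _ => map_zero (S.res _)⟩

theorem exists_one : ∃ c : PresObj R X, ∀ S φ hφ, c.val S φ hφ = 1 :=
  ⟨Quotient.mk _ .one, fun S _ _ => map_one (S.res _)⟩

theorem exists_neg (a : PresObj R X) :
    ∃ c : PresObj R X, ∀ S φ hφ, c.val S φ hφ = - a.val S φ hφ :=
  exists_unary (fun _ x => -x) .neg (fun S _ _ => map_neg (S.res _) _) a

theorem exists_add (a b : PresObj R X) :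
    ∃ c : PresObj R X, ∀ S φ hφ, c.val S φ hφ = a.val S φ hφ + b.val S φ hφ :=
  exists_binary (fun _ x y => x + y) .add (fun S _ _ _ => map_add (S.res _) _ _) a b

theorem exists_mul (a b : PresObj R X) :
    ∃ c : PresObj R X, ∀ S φ hφ, c.val S φ hφ = a.val S φ hφ * b.val S φ hφ :=
  exists_binary (fun _ x y => x * y) .mul (fun S _ _ _ => map_mul (S.res _) _ _) a b

theorem exists_res (f : X ⟶ Y) (a : PresObj R Y) :
    ∃ c : PresObj R X, ∀ S φ hφ, c.val S φ hφ = S.res f (a.val S φ hφ) :=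
  exists_unary (fun S x => S.res f x) (.res (smMap f)) (fun S φ t => by
    simp only [Term.val, Term.eval, ← S.res_comp, smMap_comm]) a

theorem exists_tr (f : X ⟶ Y) (a : PresObj R X) :
    ∃ c : PresObj R Y, ∀ S φ hφ, c.val S φ hφ = S.tr f (a.val S φ hφ) :=
  exists_unary (fun S x => S.tr f x) (.tr (smMap f)) (fun S φ t => by
    rw [Term.val, Term.eval, Term.val]
    exact S.tr_res_iso (smIso X) (smIso Y) (smMap_comm f) (t.eval S φ)) a

theorem exists_nm (f : X ⟶ Y) (a : PresObj R X) :
    ∃ c : PresObj R Y, ∀ S φ hφ, c.val S φ hφ = S.nm f (a.val S φ hφ) :=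
  exists_unary (fun S x => S.nm f x) (.nm (smMap f)) (fun S φ t => by
    rw [Term.val, Term.eval, Term.val]
    exact S.nm_res_iso (smIso X) (smIso Y) (smMap_comm f) (t.eval S φ)) a

theorem exists_glue {i : X ⟶ Z} {j : Y ⟶ Z} (h : Nonempty (IsColimit (BinaryCofan.mk i j)))
    (a : PresObj R X) (b : PresObj R Y) :
    ∃ c : PresObj R Z, ∀ S φ hφ, c.val S φ hφ = S.glue h (a.val S φ hφ) (b.val S φ hφ) :=
  exists_binary (fun S x y => S.glue h x y) (.glue (smMap i) (smMap j) (smMap_coprod h))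
    (fun S φ s t => by
      refine S.eq_glue h ?_ ?_
      · rw [Term.val, ← S.res_comp, ← smMap_comm, S.res_comp, Term.eval, (S.res_glue _ _ _).1,
          Term.val]
      · rw [Term.val, ← S.res_comp, ← smMap_comm, S.res_comp, Term.eval, (S.res_glue _ _ _).2,
          Term.val]) a b

noncomputable instance : Zero (PresObj R X) := ⟨exists_zero.choose⟩
noncomputable instance : One (PresObj R X) := ⟨exists_one.choose⟩
noncomputable instance : Neg (PresObj R X) := ⟨fun a => (exists_neg a).choose⟩
noncomputable instance : Add (PresObj R X) := ⟨fun a b => (exists_add a b).choose⟩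
noncomputable instance : Mul (PresObj R X) := ⟨fun a b => (exists_mul a b).choose⟩
noncomputable def res (f : X ⟶ Y) (a : PresObj R Y) : PresObj R X := (exists_res f a).choose
noncomputable def tr (f : X ⟶ Y) (a : PresObj R X) : PresObj R Y := (exists_tr f a).choose
noncomputable def nm (f : X ⟶ Y) (a : PresObj R X) : PresObj R Y := (exists_nm f a).choose

variable (S : TambaraFunctor.{u, w} G) (φ : ∀ X, gen X → S.obj X) (hφ : R S φ)

@[simp] theorem val_zero : (0 : PresObj R X).val S φ hφ = 0 := exists_zero.choose_spec S φ hφ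
@[simp] theorem val_one : (1 : PresObj R X).val S φ hφ = 1 := exists_one.choose_spec S φ hφ
@[simp] theorem val_neg (a : PresObj R X) : (-a).val S φ hφ = - a.val S φ hφ :=
  (exists_neg a).choose_spec S φ hφ
@[simp] theorem val_add (a b : PresObj R X) :
    (a + b).val S φ hφ = a.val S φ hφ + b.val S φ hφ := (exists_add a b).choose_spec S φ hφ
@[simp] theorem val_mul (a b : PresObj R X) :
    (a * b).val S φ hφ = a.val S φ hφ * b.val S φ hφ := (exists_mul a b).choose_spec S φ hφ
@[simp] theorem val_res (f : X ⟶ Y) (a : PresObj R Y) :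
    (a.res f).val S φ hφ = S.res f (a.val S φ hφ) := (exists_res f a).choose_spec S φ hφ
@[simp] theorem val_tr (f : X ⟶ Y) (a : PresObj R X) :
    (a.tr f).val S φ hφ = S.tr f (a.val S φ hφ) := (exists_tr f a).choose_spec S φ hφ
@[simp] theorem val_nm (f : X ⟶ Y) (a : PresObj R X) :
    (a.nm f).val S φ hφ = S.nm f (a.val S φ hφ) := (exists_nm f a).choose_spec S φ hφ

noncomputable instance : CommRing (PresObj R X) :=
  CommRing.ofMinimalAxioms
    (fun a b c => ext fun S φ hφ => by simp [add_assoc])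
    (fun a => ext fun S φ hφ => by simp)
    (fun a => ext fun S φ hφ => by simp)
    (fun a b c => ext fun S φ hφ => by simp [mul_assoc])
    (fun a b => ext fun S φ hφ => by simp [mul_comm])
    (fun a => ext fun S φ hφ => by simp)
    (fun a b c => ext fun S φ hφ => by simp [mul_add])

end PresObj

/-- The Tambara functor with generators `gen` and relations `R`. -/
noncomputable def pres : TambaraFunctor.{u, w} G where
  obj X := PresObj R X
  res f :=
    { toFun := PresObj.res f
      map_one' := PresObj.ext fun S φ hφ => by simp
      map_mul' := fun a b => PresObj.ext fun S φ hφ => by simp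
      map_zero' := PresObj.ext fun S φ hφ => by simp
      map_add' := fun a b => PresObj.ext fun S φ hφ => by simp }
  tr f :=
    { toFun := PresObj.tr f
      map_zero' := PresObj.ext fun S φ hφ => by simp
      map_add' := fun a b => PresObj.ext fun S φ hφ => by simp }
  nm f :=
    { toFun := PresObj.nm f
      map_one' := PresObj.ext fun S φ hφ => by simp
      map_mul' := fun a b => PresObj.ext fun S φ hφ => by simp }
  res_id X a := PresObj.ext fun S φ hφ => by simp [S.res_id]
  res_comp f g a := PresObj.ext fun S φ hφ => by simp [S.res_comp]
  tr_id X a := PresObj.ext fun S φ hφ => by simp [S.tr_id]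
  tr_comp f g a := PresObj.ext fun S φ hφ => by simp [S.tr_comp]
  nm_id X a := PresObj.ext fun S φ hφ => by simp [S.nm_id]
  nm_comp f g a := PresObj.ext fun S φ hφ => by simp [S.nm_comp]
  subsingleton_initial X h :=
    ⟨fun a b => PresObj.ext fun S φ hφ => (S.subsingleton_initial X h).elim _ _⟩
  bijective_coprod i j h := by
    constructor
    · intro a b hab
      have h1 : a.res i = b.res i := congrArg Prod.fst hab
      have h2 : a.res j = b.res j := congrArg Prod.snd hab
      refine PresObj.ext fun S φ hφ => (S.bijective_coprod i j h).1 (Prod.ext ?_ ?_)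
      · simpa using congrArg (fun x => PresObj.val S φ hφ x) h1
      · simpa using congrArg (fun x => PresObj.val S φ hφ x) h2
    · rintro ⟨a, b⟩
      obtain ⟨c, hc⟩ := PresObj.exists_glue ⟨h⟩ a b
      refine ⟨c, Prod.ext (PresObj.ext fun S φ hφ => ?_) (PresObj.ext fun S φ hφ => ?_)⟩
      · simp [hc, (S.res_glue ⟨h⟩ _ _).1]
      · simp [hc, (S.res_glue ⟨h⟩ _ _).2]
  mackey_tr h a := PresObj.ext fun S φ hφ => by simpa using S.mackey_tr h _
  mackey_nm h a := PresObj.ext fun S φ hφ => by simpa using S.mackey_nm h _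
  distrib h a := PresObj.ext fun S φ hφ => by simpa using S.distrib h _

/-- The morphism out of a presented Tambara functor given by an assignment satisfying the
relations. -/
noncomputable def presDesc (S : TambaraFunctor.{u, w} G) (φ : ∀ X, gen X → S.obj X)
    (hφ : R S φ) : pres R ⟶ S where
  app _ :=
    { toFun := PresObj.val S φ hφ
      map_one' := PresObj.val_one S φ hφ
      map_mul' := PresObj.val_mul S φ hφ
      map_zero' := PresObj.val_zero S φ hφ
      map_add' := PresObj.val_add S φ hφ }
  app_res f a := PresObj.val_res S φ hφ f a
  app_tr f a := PresObj.val_tr S φ hφ f a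
  app_nm f a := PresObj.val_nm S φ hφ f a

theorem pres_ext {X : FinGSet G} {a b : (pres R).obj X}
    (h : ∀ S φ hφ, (presDesc R S φ hφ).app X a = (presDesc R S φ hφ).app X b) : a = b :=
  PresObj.ext h

variable (gres : ∀ {X Y : FinGSet G}, (X ⟶ Y) → gen Y → gen X)

/-- The value of a generator in the presented Tambara functor. -/
noncomputable def presOf (X : FinGSet G) (x : gen X) : (pres R).obj X :=
  Quotient.mk (termSetoid R X) (.of (gres (smIso X).inv x))

theorem presDesc_presOf (hres : ∀ S φ, R S φ → ∀ {X Y : FinGSet G} (f : X ⟶ Y) (y : gen Y),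
    φ X (gres f y) = S.res f (φ Y y))
    (S : TambaraFunctor.{u, w} G) (φ : ∀ X, gen X → S.obj X) (hφ : R S φ)
    (X : FinGSet G) (x : gen X) :
    (presDesc R S φ hφ).app X (presOf R gres X x) = φ X x := by
  change S.res (smIso X).hom (φ _ (gres (smIso X).inv x)) = _
  rw [hres S φ hφ, ← S.res_comp, Iso.hom_inv_id, S.res_id]

/-- A morphism out of a presented Tambara functor is determined by its values on generators. -/
theorem presDesc_unique (hres : ∀ S φ, R S φ → ∀ {X Y : FinGSet G} (f : X ⟶ Y) (y : gen Y),
    φ X (gres f y) = S.res f (φ Y y))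
    {S : TambaraFunctor.{u, w} G} {ψ ψ' : pres R ⟶ S}
    (h : ∀ X x, ψ.app X (presOf R gres X x) = ψ'.app X (presOf R gres X x)) : ψ = ψ' := by
  have key : ∀ (X : FinGSet G) (t : Term gen (sm X)),
      t.val (pres R) (presOf R gres) = Quotient.mk (termSetoid R X) t := by
    intro X t
    refine pres_ext R fun S φ hφ => ?_
    rw [Term.val, (presDesc R S φ hφ).app_res, ← Term.eval_map]
    simp only [presDesc_presOf R gres hres]
    rfl
  refine hom_ext fun X a => ?_
  induction a using Quotient.inductionOn with | _ t
  rw [← key, Term.val, ψ.app_res, ψ'.app_res, ← Term.eval_map, ← Term.eval_map]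
  simp only [h]

end Presentation

/-! ## The Tambarization functor, coproducts and pushouts -/

section Existence

section Tambarization

variable (M : SemiMackeyFunctor.{u, w} G)

/-- An assignment of values to the elements of `M` that is a morphism `M → S^μ`. -/
def tambarizationRel : Relations M.obj :=
  fun S φ => ∃ θ : M ⟶ (mulPart G).obj S, ∀ X x, φ X x = θ.app X x

theorem tambarizationRel_res (S : TambaraFunctor.{u, w} G) (φ : ∀ X, M.obj X → S.obj X)
    (h : tambarizationRel M S φ) {X Y : FinGSet G} (f : X ⟶ Y) (y : M.obj Y) :
    φ X (M.res f y) = S.res f (φ Y y) := by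
  obtain ⟨θ, hθ⟩ := h
  rw [hθ, hθ]
  exact θ.app_res f y

variable [Finite G]

noncomputable def tambarizationUnit : M ⟶ (mulPart G).obj (pres (tambarizationRel M)) where
  app X :=
    { toFun := presOf (tambarizationRel M) (fun f => M.res f) X
      map_one' := pres_ext _ fun S φ hφ => by
        obtain ⟨θ, hθ⟩ := id hφ
        rw [presDesc_presOf _ _ (tambarizationRel_res M), hθ, map_one]
        exact (map_one _).symm
      map_mul' := fun a b => pres_ext _ fun S φ hφ => by
        obtain ⟨θ, hθ⟩ := id hφ
        rw [presDesc_presOf _ _ (tambarizationRel_res M), hθ, map_mul]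
        refine Eq.trans ?_ (map_mul _ _ _).symm
        rw [presDesc_presOf _ _ (tambarizationRel_res M),
          presDesc_presOf _ _ (tambarizationRel_res M), hθ, hθ]
        rfl }
  app_res f a := pres_ext _ fun S φ hφ => by
    refine (presDesc_presOf _ _ (tambarizationRel_res M) S φ hφ _ _).trans ?_
    refine Eq.trans ?_ ((presDesc _ S φ hφ).app_res f _).symm
    refine Eq.trans ?_ (congrArg (S.res f)
      (presDesc_presOf _ _ (tambarizationRel_res M) S φ hφ _ _).symm)
    exact tambarizationRel_res M S φ hφ f a
  app_tr f a := pres_ext _ fun S φ hφ => by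
    refine (presDesc_presOf _ _ (tambarizationRel_res M) S φ hφ _ _).trans ?_
    refine Eq.trans ?_ ((presDesc _ S φ hφ).app_nm f _).symm
    refine Eq.trans ?_ (congrArg (S.nm f)
      (presDesc_presOf _ _ (tambarizationRel_res M) S φ hφ _ _).symm)
    obtain ⟨θ, hθ⟩ := id hφ
    rw [hθ, hθ]
    exact θ.app_tr f a

noncomputable def tambarizationEquiv (S : TambaraFunctor.{u, w} G) :
    (pres (tambarizationRel M) ⟶ S) ≃ (M ⟶ (mulPart G).obj S) where
  toFun ψ := tambarizationUnit M ≫ (mulPart G).map ψ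
  invFun θ := presDesc _ S (fun X x => θ.app X x) ⟨θ, fun _ _ => rfl⟩
  left_inv _ := presDesc_unique _ _ (tambarizationRel_res M) fun X x =>
    presDesc_presOf _ _ (tambarizationRel_res M) S _ _ X x
  right_inv θ := SemiMackeyFunctor.Hom.ext (funext fun X => MonoidHom.ext fun x =>
    presDesc_presOf _ _ (tambarizationRel_res M) S _ ⟨θ, fun _ _ => rfl⟩ X x)

end Tambarization

/-- The functor `T ↦ T^μ` has a left adjoint. -/
instance [Finite G] : (mulPart.{u, w} G).IsRightAdjoint :=
  ⟨_, ⟨Adjunction.adjunctionOfEquivLeft (G := mulPart.{u, w} G)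
    (F_obj := fun M => pres (tambarizationRel M)) (fun M S => tambarizationEquiv M S)
    (fun _ _ _ _ _ => rfl)⟩⟩

section Colimits

variable {J : Type} [Category.{0} J] (F : J ⥤ TambaraFunctor.{u, w} G)

/-- An assignment of values to the elements of the `F(j)` that is a cocone. -/
def colimitRel : Relations (fun X => Σ j, (F.obj j).obj X) :=
  fun S φ => ∃ θ : F ⟶ (Functor.const J).obj S, ∀ X x, φ X x = (θ.app x.1).app X x.2

/-- Restriction of generators. -/
def colimitRes {X Y : FinGSet G} (f : X ⟶ Y) (y : Σ j, (F.obj j).obj Y) :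
    Σ j, (F.obj j).obj X :=
  ⟨y.1, (F.obj y.1).res f y.2⟩

theorem colimitRel_res (S : TambaraFunctor.{u, w} G)
    (φ : ∀ X, (Σ j, (F.obj j).obj X) → S.obj X)
    (h : colimitRel F S φ) {X Y : FinGSet G} (f : X ⟶ Y) (y : Σ j, (F.obj j).obj Y) :
    φ X (colimitRes F f y) = S.res f (φ Y y) := by
  obtain ⟨θ, hθ⟩ := h
  rw [hθ, hθ]
  exact (θ.app y.1).app_res f y.2

variable [Finite G]

noncomputable def colimitOf (j : J) (X : FinGSet G) (x : (F.obj j).obj X) :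
    (pres (colimitRel F)).obj X :=
  presOf (colimitRel F) (colimitRes F) X ⟨j, x⟩

theorem desc_colimitOf {S : TambaraFunctor.{u, w} G} {φ : ∀ X, (Σ j, (F.obj j).obj X) → S.obj X}
    (hφ : colimitRel F S φ) (j : J) (X : FinGSet G) (x : (F.obj j).obj X) :
    (presDesc _ S φ hφ).app X (colimitOf F j X x) = (hφ.choose.app j).app X x :=
  (presDesc_presOf _ _ (colimitRel_res F) S φ hφ X ⟨j, x⟩).trans (hφ.choose_spec X ⟨j, x⟩)

noncomputable def colimitCocone : Cocone F where
  pt := pres (colimitRel F)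
  ι :=
    { app := fun j =>
        { app := fun X =>
            { toFun := colimitOf F j X
              map_one' := pres_ext _ fun S φ hφ => by simp [desc_colimitOf]
              map_mul' := fun a b => pres_ext _ fun S φ hφ => by simp [desc_colimitOf]
              map_zero' := pres_ext _ fun S φ hφ => by simp [desc_colimitOf]
              map_add' := fun a b => pres_ext _ fun S φ hφ => by simp [desc_colimitOf] }
          app_res := fun f a => pres_ext _ fun S φ hφ => by
            refine (desc_colimitOf F hφ _ _ _).trans ?_
            refine ((hφ.choose.app j).app_res f a).trans ?_
            refine Eq.trans ?_ ((presDesc _ S φ hφ).app_res f _).symm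
            exact congrArg (S.res f) (desc_colimitOf F hφ _ _ _).symm
          app_tr := fun f a => pres_ext _ fun S φ hφ => by
            refine (desc_colimitOf F hφ _ _ _).trans ?_
            refine ((hφ.choose.app j).app_tr f a).trans ?_
            refine Eq.trans ?_ ((presDesc _ S φ hφ).app_tr f _).symm
            exact congrArg (S.tr f) (desc_colimitOf F hφ _ _ _).symm
          app_nm := fun f a => pres_ext _ fun S φ hφ => by
            refine (desc_colimitOf F hφ _ _ _).trans ?_
            refine ((hφ.choose.app j).app_nm f a).trans ?_
            refine Eq.trans ?_ ((presDesc _ S φ hφ).app_nm f _).symm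
            exact congrArg (S.nm f) (desc_colimitOf F hφ _ _ _).symm }
      naturality := fun j k f => hom_ext fun X a => pres_ext _ fun S φ hφ => by
        refine (desc_colimitOf F hφ k X _).trans (Eq.trans ?_ (desc_colimitOf F hφ j X a).symm)
        exact congrArg (fun ψ : F.obj j ⟶ S => ψ.app X a) (hφ.choose.naturality f) }

noncomputable def colimitIsColimit : IsColimit (colimitCocone F) where
  desc s := presDesc _ s.pt (fun X x => (s.ι.app x.1).app X x.2) ⟨s.ι, fun _ _ => rfl⟩
  fac s j := hom_ext fun X x =>
    presDesc_presOf _ _ (colimitRel_res F) s.pt _ ⟨s.ι, fun _ _ => rfl⟩ X ⟨j, x⟩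
  uniq s m hm := presDesc_unique _ _ (colimitRel_res F) fun X x => by
    refine Eq.trans ?_
      (presDesc_presOf _ _ (colimitRel_res F) s.pt _ ⟨s.ι, fun _ _ => rfl⟩ X x).symm
    exact congrArg (fun ψ : F.obj x.1 ⟶ s.pt => ψ.app X x.2) (hm x.1)

end Colimits

variable [Finite G]

instance : HasColimitsOfSize.{0, 0} (TambaraFunctor.{u, w} G) :=
  ⟨fun _ _ => ⟨fun F => ⟨⟨⟨colimitCocone F, colimitIsColimit F⟩⟩⟩⟩⟩

instance (T : TambaraFunctor.{u, w} G) : HasBinaryCoproducts (Under T) := by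
  refine @hasBinaryCoproducts_of_hasColimit_pair _ _ fun {A B} => ⟨⟨⟨BinaryCofan.mk
    (P := Under.mk (A.hom ≫ pushout.inl A.hom B.hom))
    (Under.homMk (pushout.inl A.hom B.hom))
    (Under.homMk (pushout.inr A.hom B.hom) pushout.condition.symm), ?_⟩⟩⟩
  have ex (S : Under T) (a : A ⟶ S) (b : B ⟶ S) :
      ∃ c : Under.mk (A.hom ≫ pushout.inl A.hom B.hom) ⟶ S,
        pushout.inl A.hom B.hom ≫ c.right = a.right ∧
        pushout.inr A.hom B.hom ≫ c.right = b.right := by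
    have hab : A.hom ≫ a.right = B.hom ≫ b.right := (Under.w a).trans (Under.w b).symm
    obtain ⟨c, h1, h2⟩ : ∃ c : pushout A.hom B.hom ⟶ S.right,
        pushout.inl A.hom B.hom ≫ c = a.right ∧ pushout.inr A.hom B.hom ≫ c = b.right :=
      ⟨pushout.desc a.right b.right hab, pushout.inl_desc _ _ _, pushout.inr_desc _ _ _⟩
    exact ⟨Under.homMk c ((Category.assoc _ _ _).trans
      ((congrArg (A.hom ≫ ·) h1).trans (Under.w a))), h1, h2⟩
  exact BinaryCofan.isColimitMk (fun s => (ex _ s.inl s.inr).choose)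
    (fun s => Under.UnderMorphism.ext (ex _ s.inl s.inr).choose_spec.1)
    (fun s => Under.UnderMorphism.ext (ex _ s.inl s.inr).choose_spec.2)
    (fun s m h h' => Under.UnderMorphism.ext (pushout.hom_ext
      ((congrArg (fun k => k.right) h).trans (ex _ s.inl s.inr).choose_spec.1.symm)
      ((congrArg (fun k => k.right) h').trans (ex _ s.inl s.inr).choose_spec.2.symm)))

end Existence

section SemigroupRing

variable [Finite G]

/-- The Tambarization functor `M ↦ Ω[M]`, the left adjoint of `T ↦ T^μ`. -/
noncomputable def tambarization (G : Type u) [Group G] [Finite G] :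
    SemiMackeyFunctor.{u, w} G ⥤ TambaraFunctor.{u, w} G :=
  (mulPart.{u, w} G).leftAdjoint

variable (T : TambaraFunctor.{u, w} G)

/-- The functor `M ↦ T[M] = T ⊗_Ω Ω[M]` from semi-Mackey functors to `T`-Tambara functors. Here
`⊗_Ω` is the coproduct of Tambara functors, and `T`-Tambara functors are Tambara functors under
`T`. -/
noncomputable def semigroupRing : SemiMackeyFunctor.{u, w} G ⥤ Under T where
  obj M := Under.mk (coprod.inl : T ⟶ T ⨿ (tambarization G).obj M)
  map φ := Under.homMk (coprod.map (𝟙 T) ((tambarization G).map φ)) (by simp)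

end SemigroupRing

end TambaraFunctor

/-! # `T`-Tambara functors -/

namespace TTambara

variable {G : Type u} [Group G] [Finite G] (T : TambaraFunctor.{u, w} G)

/-- `T` as a `T`-Tambara functor. -/
abbrev base : Under T := Under.mk (𝟙 T)

variable {T}

/-- The structure morphism `ι_T : T → S` of a `T`-Tambara functor `S`. -/
def structureMap (S : Under T) : base T ⟶ S := Under.homMk S.hom

/-- `A ⊗_T B`: the coproduct in the category of `T`-Tambara functors. -/
noncomputable abbrev tensor (A B : Under T) : Under T := A ⨿ B

/-- `f ⊗_T g : A ⊗_T B → A' ⊗_T B'`. -/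
noncomputable abbrev tensorMap {A A' B B' : Under T} (f : A ⟶ A') (g : B ⟶ B') :
    tensor A B ⟶ tensor A' B' :=
  coprod.map f g

/-- The canonical isomorphism `(A ⊗_T B) ⊗_T C ≅ A ⊗_T (B ⊗_T C)`. -/
noncomputable abbrev assocIso (A B C : Under T) :
    tensor (tensor A B) C ≅ tensor A (tensor B C) :=
  coprod.associator A B C

/-- The canonical isomorphism `A ≅ T ⊗_T A`. -/
noncomputable def leftUnitIso (A : Under T) : A ≅ tensor (base T) A where
  hom := coprod.inr
  inv := coprod.desc (structureMap A) (𝟙 A)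
  hom_inv_id := coprod.inr_desc _ _
  inv_hom_id := by
    apply coprod.hom_ext
    · exact Under.mkIdInitial.hom_ext _ _
    · rw [← Category.assoc, coprod.inr_desc, Category.id_comp, Category.comp_id]

/-- The canonical isomorphism `A ≅ A ⊗_T T`. -/
noncomputable def rightUnitIso (A : Under T) : A ≅ tensor A (base T) where
  hom := coprod.inl
  inv := coprod.desc (𝟙 A) (structureMap A)
  hom_inv_id := coprod.inl_desc _ _
  inv_hom_id := by
    apply coprod.hom_ext
    · rw [← Category.assoc, coprod.inl_desc, Category.id_comp, Category.comp_id]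
    · exact Under.mkIdInitial.hom_ext _ _

/-- The multiplication `∇ : A ⊗_T A → A`, inducing the identity on each component. -/
noncomputable abbrev fold (A : Under T) : tensor A A ⟶ A := coprod.desc (𝟙 A) (𝟙 A)

variable (T) in
/-- The canonical morphism `T[M] ⊗_T T[N] → T[M ⊕ N]` induced by the inclusions of `M` and `N` into
`M ⊕ N`. -/
noncomputable def canonical (M N : SemiMackeyFunctor.{u, w} G) :
    tensor (T.semigroupRing.obj M) (T.semigroupRing.obj N) ⟶
      T.semigroupRing.obj (M.directSum N) :=
  coprod.desc (T.semigroupRing.map (SemiMackeyFunctor.inl M N))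
    (T.semigroupRing.map (SemiMackeyFunctor.inr M N))

end TTambara

/-! The functor `T[-]` behaves as a left adjoint. A morphism `T[M] → S` under `T` amounts to a
morphism `Ω[M] → S` of Tambara functors, since the component on `T` is forced, hence to a morphism
`M → S^μ` of semi-Mackey functors (`restrict_injective`, `restrict_surjective`). As the values of
semi-Mackey functors are commutative monoids, `M ⊕ N` is a coproduct and `0` is initial; left
adjoints preserve both, so `T[M ⊕ N]` is `T[M] ⊗_T T[N]` and `T[0]` is `T` (`isIso_canonical`,
`isIso_structureMap_zero`).

By the same correspondence a morphism out of `T[M]` is determined by its values on the elements `a`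
of `M(X)` (`value_ext`), and these values are multiplicative in `a`. On such elements the structure
is that of a group ring: the comultiplication sends `a` to the product of its two images
(`value_comul_comp`), the counit sends it to `1` (`value_counit_comp`), and the antipode sends it to
the image of `a⁻¹`. The Hopf identities thus become associativity, the unit law and `a * a⁻¹ = 1`.
Invertibility in `M` enters only through the antipode. -/

namespace SemiMackeyFunctor

variable {G : Type u} [Group G]

/-! ### Morphisms out of direct sums and zero in semi-Mackey functors -/

/-- The morphism `M ⊕ N → P` with given components. -/
def directSumDesc {M N P : SemiMackeyFunctor.{u, w} G} (α : M ⟶ P) (β : N ⟶ P) :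
    M.directSum N ⟶ P where
  -- Sending `(a, b)` to `α a * β b` is a homomorphism because `P(X)` is commutative.
  app X := (α.app X).coprod (β.app X)
  app_res f a := by
    refine Eq.trans ?_ (map_mul (P.res f) (α.app _ a.1) (β.app _ a.2)).symm
    exact congrArg₂ (· * ·) (α.app_res f a.1) (β.app_res f a.2)
  app_tr f a := by
    refine Eq.trans ?_ (map_mul (P.tr f) (α.app _ a.1) (β.app _ a.2)).symm
    exact congrArg₂ (· * ·) (α.app_tr f a.1) (β.app_tr f a.2)

/-- The zero morphism `0 → P`. -/
def ofZero (P : SemiMackeyFunctor.{u, w} G) : zero ⟶ P where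
  app _ := 1
  app_res f _ := (map_one (P.res f)).symm
  app_tr f _ := (map_one (P.tr f)).symm

end SemiMackeyFunctor

namespace TTambara

variable {G : Type u} [Group G] [Finite G] {T : TambaraFunctor.{u, w} G}
  {M N : SemiMackeyFunctor.{u, w} G} {S S' : Under T}

/-! ### The universal property of `T[M]` -/

variable (T M) in
/-- The canonical morphism `M → T[M]^μ`. -/
noncomputable def generators :
    M ⟶ (TambaraFunctor.mulPart G).obj (T.semigroupRing.obj M).right :=
  (Adjunction.ofIsRightAdjoint (TambaraFunctor.mulPart.{u, w} G)).homEquiv _ _ coprod.inr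

/-- The morphism `M → S^μ` corresponding to a morphism `T[M] → S` of `T`-Tambara functors. -/
noncomputable def restrict (f : T.semigroupRing.obj M ⟶ S) :
    M ⟶ (TambaraFunctor.mulPart G).obj S.right :=
  generators T M ≫ (TambaraFunctor.mulPart G).map f.right

/-- Naturality of the adjunction in the target. The two descriptions serve different ends: the
definition of `restrict` is compatible with postcomposition, while the adjoint transpose gives
bijectivity and naturality in `M`. -/
theorem restrict_eq_homEquiv (f : T.semigroupRing.obj M ⟶ S) :
    restrict f = (Adjunction.ofIsRightAdjoint (TambaraFunctor.mulPart.{u, w} G)).homEquiv _ _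
      (coprod.inr ≫ f.right) :=
  (Adjunction.homEquiv_naturality_right _ _ _).symm

/-- The two components of a map out of `T ⨿ Ω[M]` are both known: the one on `T` is the structure
map of `S`, and the one on `Ω[M]` is recovered from its transpose. -/
theorem restrict_injective :
    Function.Injective (restrict : (T.semigroupRing.obj M ⟶ S) → _) := by
  intro f g h
  rw [restrict_eq_homEquiv, restrict_eq_homEquiv, EmbeddingLike.apply_eq_iff_eq] at h
  exact Under.UnderMorphism.ext (coprod.hom_ext ((Under.w f).trans (Under.w g).symm) h)

theorem restrict_surjective :
    Function.Surjective (restrict : (T.semigroupRing.obj M ⟶ S) → _) := by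
  intro θ
  -- Taking the structure map of `S` as the component on `T` is what makes this a morphism under
  -- `T`.
  refine ⟨Under.homMk (coprod.desc S.hom
    (((Adjunction.ofIsRightAdjoint (TambaraFunctor.mulPart.{u, w} G)).homEquiv _ _).symm θ))
    (coprod.inl_desc _ _), ?_⟩
  rw [restrict_eq_homEquiv, ← Equiv.eq_symm_apply]
  exact coprod.inr_desc _ _

theorem restrict_map_comp (φ : M ⟶ N) (f : T.semigroupRing.obj N ⟶ S) :
    restrict (T.semigroupRing.map φ ≫ f) = φ ≫ restrict f := by
  rw [restrict_eq_homEquiv, restrict_eq_homEquiv, ← Adjunction.homEquiv_naturality_left]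
  refine congrArg _ ?_
  refine (Category.assoc _ _ _).symm.trans ?_
  -- On the summand `Ω[M]`, the map `T[φ]` is `Ω[φ]`, so naturality of the adjunction in `M`
  -- applies.
  refine (congrArg (· ≫ f.right) (coprod.inr_map _ _)).trans (Category.assoc _ _ _)

/-- The values of a morphism `T[M] → S` on the elements of `M(X)`. -/
noncomputable def value (f : T.semigroupRing.obj M ⟶ S) (X : FinGSet G) :
    M.obj X →* S.right.obj X :=
  (restrict f).app X

/-- The elements of `M` generate `T[M]` over `T`. All later equations between morphisms out of
`T[M]` are checked through this criterion. -/
theorem value_ext {f g : T.semigroupRing.obj M ⟶ S} (h : ∀ X a, value f X a = value g X a) :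
    f = g :=
  restrict_injective (SemiMackeyFunctor.Hom.ext (funext fun X => MonoidHom.ext (h X)))

theorem value_comp (f : T.semigroupRing.obj M ⟶ S) (g : S ⟶ S') (X : FinGSet G) (a : M.obj X) :
    value (f ≫ g) X a = g.right.app X (value f X a) :=
  rfl

theorem value_map_comp (φ : M ⟶ N) (f : T.semigroupRing.obj N ⟶ S) (X : FinGSet G)
    (a : M.obj X) : value (T.semigroupRing.map φ ≫ f) X a = value f X (φ.app X a) :=
  congrArg (fun θ : M ⟶ (TambaraFunctor.mulPart G).obj S.right => θ.app X a)
    (restrict_map_comp φ f)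

/-- Since `(a, b) = (a, 1) * (1, b)`, multiplicativity splits the value into the contributions of
the two inclusions. -/
theorem value_directSum (f : T.semigroupRing.obj (M.directSum N) ⟶ S) (X : FinGSet G)
    (a : M.obj X) (b : N.obj X) :
    value f X (a, b) = value (T.semigroupRing.map (SemiMackeyFunctor.inl M N) ≫ f) X a *
      value (T.semigroupRing.map (SemiMackeyFunctor.inr M N) ≫ f) X b := by
  rw [value_map_comp, value_map_comp]
  refine Eq.trans (congrArg (value f X) ?_) (map_mul (value f X) _ _)
  exact Prod.ext (mul_one a).symm (one_mul b).symm

/-! ### Direct sums and zero under `T[-]` -/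

theorem inl_canonical :
    coprod.inl ≫ canonical T M N = T.semigroupRing.map (SemiMackeyFunctor.inl M N) :=
  coprod.inl_desc _ _

theorem inr_canonical :
    coprod.inr ≫ canonical T M N = T.semigroupRing.map (SemiMackeyFunctor.inr M N) :=
  coprod.inr_desc _ _

/-- The semigroup ring functor sends direct sums to coproducts of `T`-Tambara functors. -/
instance isIso_canonical : IsIso (canonical T M N) := by
  -- The inverse is the map sending `(a, b)` to the product of the images of `a` and `b` under the
  -- two coprojections.
  obtain ⟨g, hg⟩ := restrict_surjective (T := T) (SemiMackeyFunctor.directSumDesc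
    (restrict (coprod.inl : T.semigroupRing.obj M ⟶ T.semigroupRing.obj M ⨿ T.semigroupRing.obj N))
    (restrict (coprod.inr : T.semigroupRing.obj N ⟶ _)))
  have hv : ∀ X (a : (M.directSum N).obj X), value g X a =
      value (coprod.inl : T.semigroupRing.obj M ⟶ T.semigroupRing.obj M ⨿ T.semigroupRing.obj N)
        X a.1 * value (coprod.inr : T.semigroupRing.obj N ⟶ _) X a.2 := fun X a =>
    congrArg (fun θ : M.directSum N ⟶ (TambaraFunctor.mulPart G).obj _ => θ.app X a) hg
  refine ⟨g, coprod.hom_ext (value_ext fun X a => ?_) (value_ext fun X a => ?_),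
    value_ext fun X a => ?_⟩
  -- On the first factor, `g` is evaluated at `(a, 1)`, and the second coprojection contributes `1`;
  -- the next case is symmetric.
  · rw [← Category.assoc, inl_canonical, value_map_comp, hv, Category.comp_id]
    exact (congrArg (_ * ·) (map_one (value _ X))).trans (mul_one _)
  · rw [← Category.assoc, inr_canonical, value_map_comp, hv, Category.comp_id]
    exact (congrArg (· * _) (map_one (value _ X))).trans (one_mul _)
  -- Here the composite sends `(a, b)` to the product of the images of `(a, 1)` and `(1, b)`, which
  -- is the decomposition of the identity given by `value_directSum`.
  · rw [value_comp, hv, map_mul, ← value_comp, ← value_comp, inl_canonical, inr_canonical]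
    refine Eq.trans ?_ (value_directSum (𝟙 _) X a.1 a.2).symm
    rw [Category.comp_id, Category.comp_id]

theorem value_of_zero (f : T.semigroupRing.obj SemiMackeyFunctor.zero ⟶ S) (X : FinGSet G)
    (a : SemiMackeyFunctor.zero.obj X) : value f X a = 1 :=
  map_one (value f X)

/-- The semigroup ring of `0` is the initial `T`-Tambara functor. -/
instance isIso_structureMap_zero :
    IsIso (structureMap (T.semigroupRing.obj SemiMackeyFunctor.zero)) := by
  -- Only the existence of `g` matters: `base T` is initial, and any two morphisms out of `T[0]`
  -- agree because all their values are `1`.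
  obtain ⟨g, -⟩ := restrict_surjective (T := T) (S := base T) (SemiMackeyFunctor.ofZero _)
  exact ⟨g, Under.mkIdInitial.hom_ext _ _, value_ext fun X a => by
    rw [value_of_zero, value_of_zero]⟩

/-! ### The comultiplication and the counit on elements of `M` -/

variable (T M) in
/-- The comultiplication of `T[M]`. -/
noncomputable def comul :
    T.semigroupRing.obj M ⟶ tensor (T.semigroupRing.obj M) (T.semigroupRing.obj M) :=
  T.semigroupRing.map M.diag ≫ inv (canonical T M M)

variable (T M) in
/-- The counit of `T[M]`. -/
noncomputable def counit : T.semigroupRing.obj M ⟶ base T :=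
  T.semigroupRing.map M.toZero ≫ inv (structureMap (T.semigroupRing.obj SemiMackeyFunctor.zero))

/-- The elements of `M` are group-like: composition with the comultiplication multiplies the
values of the two components. -/
theorem value_comul_comp
    (f : tensor (T.semigroupRing.obj M) (T.semigroupRing.obj M) ⟶ S) (X : FinGSet G)
    (a : M.obj X) :
    value (comul T M ≫ f) X a = value (coprod.inl ≫ f) X a * value (coprod.inr ≫ f) X a := by
  rw [comul, Category.assoc, value_map_comp]
  refine (value_directSum _ X a a).trans ?_
  -- Each inclusion factors through `canonical`, which then cancels against the inverse used to
  -- define `comul`.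
  rw [← inl_canonical, ← inr_canonical, Category.assoc, Category.assoc,
    IsIso.hom_inv_id_assoc]

/-- The counit factors through `T[0]`, where every generator has value `1`. -/
theorem value_counit_comp (f : base T ⟶ S) (X : FinGSet G) (a : M.obj X) :
    value (counit T M ≫ f) X a = 1 := by
  rw [counit, Category.assoc, value_map_comp, value_of_zero]

/-! ### The Hopf identities -/

/-- Both sides send `a` to the product of its images under the three coprojections, with different
bracketings. -/
theorem comul_coassoc :
    comul T M ≫ tensorMap (comul T M) (𝟙 _) ≫ (assocIso _ _ _).hom =
      comul T M ≫ tensorMap (𝟙 _) (comul T M) :=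
  value_ext fun X a => by
    simp only [value_comul_comp, coprod.inl_map_assoc, coprod.inr_map_assoc, coprod.inl_map,
      coprod.inr_map, coprod.associator_hom, coprod.inl_desc, coprod.inr_desc, Category.id_comp,
      mul_assoc]

theorem comul_counit_left :
    comul T M ≫ tensorMap (counit T M) (𝟙 _) = (leftUnitIso _).hom :=
  value_ext fun X a => by
    rw [value_comul_comp, coprod.inl_map, coprod.inr_map, value_counit_comp, one_mul,
      Category.id_comp]
    -- What remains of the product is the second coprojection, which is the unit isomorphism by
    -- definition.
    rfl

theorem comul_counit_right :
    comul T M ≫ tensorMap (𝟙 _) (counit T M) = (rightUnitIso _).hom :=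
  value_ext fun X a => by
    rw [value_comul_comp, coprod.inl_map, coprod.inr_map, value_counit_comp, mul_one,
      Category.id_comp]
    rfl

theorem comul_antipode_left (M : MackeyFunctor.{u, w} G) :
    comul T M.obj ≫ tensorMap (T.semigroupRing.map M.inversion) (𝟙 _) ≫ fold _ =
      counit T M.obj ≫ structureMap _ :=
  value_ext fun X a => by
    rw [value_comul_comp, coprod.inl_map_assoc, coprod.inr_map_assoc, coprod.inl_desc,
      coprod.inr_desc, value_map_comp, Category.id_comp, value_counit_comp, ← map_mul]
    -- Folding has merged the two factors into the single value at `a⁻¹ * a = 1`, while the counit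
    -- side is already `1`.
    exact (congrArg _ ((mul_comm _ _).trans (M.mul_inv_self a))).trans (map_one _)

theorem comul_antipode_right (M : MackeyFunctor.{u, w} G) :
    comul T M.obj ≫ tensorMap (𝟙 _) (T.semigroupRing.map M.inversion) ≫ fold _ =
      counit T M.obj ≫ structureMap _ :=
  value_ext fun X a => by
    rw [value_comul_comp, coprod.inl_map_assoc, coprod.inr_map_assoc, coprod.inl_desc,
      coprod.inr_desc, value_map_comp, Category.id_comp, value_counit_comp, ← map_mul]
    exact (congrArg _ (M.mul_inv_self a)).trans (map_one _)

end TTambara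

open TTambara in
theorem mainTheorem4 {G : Type u} [Group G] [Finite G] (T : TambaraFunctor.{u, w} G)
    (M : MackeyFunctor.{u, w} G) :
    -- the identifications `T[M] ⊗_T T[M] ≅ T[M ⊕ M]` and `T ≅ T[0]`
    IsIso (canonical T M.obj M.obj) ∧
    IsIso (structureMap (T.semigroupRing.obj SemiMackeyFunctor.zero)) ∧
    ∃ (Δ : T.semigroupRing.obj M.obj ⟶
          tensor (T.semigroupRing.obj M.obj) (T.semigroupRing.obj M.obj))
      (ε : T.semigroupRing.obj M.obj ⟶ base T)
      (η : T.semigroupRing.obj M.obj ⟶ T.semigroupRing.obj M.obj),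
      -- they are induced by the diagonal, the zero morphism and the inversion
      Δ ≫ canonical T M.obj M.obj = T.semigroupRing.map M.obj.diag ∧
      ε ≫ structureMap (T.semigroupRing.obj SemiMackeyFunctor.zero) =
        T.semigroupRing.map M.obj.toZero ∧
      η = T.semigroupRing.map M.inversion ∧
      -- coassociativity
      Δ ≫ tensorMap Δ (𝟙 _) ≫ (assocIso _ _ _).hom = Δ ≫ tensorMap (𝟙 _) Δ ∧
      -- counit
      Δ ≫ tensorMap ε (𝟙 _) = (leftUnitIso _).hom ∧
      Δ ≫ tensorMap (𝟙 _) ε = (rightUnitIso _).hom ∧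
      -- antipode
      Δ ≫ tensorMap η (𝟙 _) ≫ fold _ = ε ≫ structureMap _ ∧
      Δ ≫ tensorMap (𝟙 _) η ≫ fold _ = ε ≫ structureMap _ := by
  -- The two remaining goals cancel the inverse isomorphisms in the definitions of `comul` and
  -- `counit`.
  refine ⟨inferInstance, inferInstance, comul T M.obj, counit T M.obj,
    T.semigroupRing.map M.inversion, ?_, ?_, rfl, comul_coassoc, comul_counit_left,
    comul_counit_right, comul_antipode_left M, comul_antipode_right M⟩
  · rw [comul, Category.assoc, IsIso.inv_hom_id, Category.comp_id]
  · rw [counit, Category.assoc, IsIso.inv_hom_id, Category.comp_id]
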